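/- Let $q$ be a prime with $8 \mid q+1$. The quadratic-residue code of length $q$ is the binary cyclic code spanned by all cyclic shifts of the cyclic generator, the vector in $\mathbb{F}_2^q$ (positions $1,\dots,q$) with entry $1$ exactly at the nonzero quadratic residues modulo $q$. Let $\mathbf{H}_{\mathbf{s}}^{\mathrm{QRC}}$ be the $q \times n$ matrix over $\mathbb{F}_2$ whose first column is the all-ones vector and whose remaining columns are the basis of this code formed by the cyclic generator and its successive cyclic shifts (by $0,1,2,\dots$ places downwards); such a matrix exists, and $n=(q+3)/2$. For a binary matrix $\mathbf{H}$ with $n$ columns put $\mathsf{Ham}(\mathbf{H})=\sum_{\mathbf{p}} X_1^{p_1}\otimes\cdots\otimes X_n^{p_n}$ (sum over the rows $\mathbf{p}$ of $\mathbf{H}$), and let $H_{\mathbf{s}}=\mathsf{Ham}(\mathbf{H}_{\mathbf{s}}^{\mathrm{QRC}})$. A stabilizer tableau of a stabilizer state is an $n\times(2n+1)$ binary matrix whose rows $(x_1,\dots,x_n,z_1,\dots,z_n,r)$ encode Pauli operators $(-1)^r P_1\otimes\cdots\otimes P_n$, with $P_k = I, X, Z, Y$ for $(x_k,z_k)=(0,0),(1,0),(0,1),(1,1)$,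 that generate the stabilizer group of the state (all elements of the Pauli group that fix it) and determine the state up to a scalar. Then the state $e^{i\pi H_{\mathbf{s}}/4}|0^n\rangle$ has the stabilizer tableau $$\left(\begin{array}{ccc|ccc|c} 1&\cdots&1&1&\cdots&0&1\\ \vdots&\ddots&\vdots&\vdots&\ddots&\vdots&\vdots\\ 1&\cdots&1&0&\cdots&1&1\end{array}\right),$$ that is, the $X$ part is the all-ones $n\times n$ matrix, the $Z$ part is the identity matrix, and the phase column is all ones. As a result, the stabilizer group of this state is generated by $-Y_1X_2\cdots X_n$, $-X_1Y_2X_3\cdots X_n$, $\ldots$, $-X_1\cdots X_{n-1}Y_n$. Moreover, let $\mathbf{s}\in\mathbb{F}_2^n$ satisfy $\mathbf{H}_{\mathbf{s}}^{\mathrm{QRC}}\mathbf{s}=\mathbf{1}$ (for instance $\mathbf{s}=(1,0,\dots,0)^T$), let $\mathbf{R}$ be any matrix over $\mathbb{F}_2$ with $n$ columns and $\mathbf{R}\mathbf{s}=\mathbf{0}$, let $\mathbf{H}$ be $\mathbf{H}_{\mathbf{s}}^{\mathrm{QRC}}$ with the rows of $\mathbf{R}$ added below, and let $U=e^{i\pi\mathsf{Ham}(\mathbf{H})/8}$.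 Then the correlation function $\langle\mathcal{Z}_{\mathbf{s}}\rangle=\langle 0^n|U^\dagger (Z_1^{s_1}\otimes\cdots\otimes Z_n^{s_n}) U|0^n\rangle$ equals $\langle 0^n|e^{i\pi H_{\mathbf{s}}/4}|0^n\rangle$, and its magnitude is $1/\sqrt{2}$. -/

import Mathlib

open Matrix

noncomputable section

/-! ### Qubits and Pauli operators -/

/-- Linear operators on `n` qubits, as matrices in the computational basis
`{0,1}^n`. -/
abbrev QOp (n : ℕ) : Type := Matrix (Fin n → Fin 2) (Fin n → Fin 2) ℂ

/-- Vectors of `n` qubits: amplitudes in the computational basis. -/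
abbrev QVec (n : ℕ) : Type := (Fin n → Fin 2) → ℂ

/-- The basis state `|0^n⟩`. -/
def ketZero (n : ℕ) : QVec n := Pi.single 0 1

def pauliX : Matrix (Fin 2) (Fin 2) ℂ := !![0, 1; 1, 0]

def pauliY : Matrix (Fin 2) (Fin 2) ℂ := !![0, -Complex.I; Complex.I, 0]

def pauliZ : Matrix (Fin 2) (Fin 2) ℂ := !![1, 0; 0, -1]

/-- The tensor product `A₁ ⊗ ⋯ ⊗ Aₙ` of one-qubit operators. -/
def tensorOp {n : ℕ} (A : Fin n → Matrix (Fin 2) (Fin 2) ℂ) : QOp n :=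
  Matrix.of fun x y => ∏ k, A k (x k) (y k)

/-- The one-qubit Pauli operator encoded by two bits:
`00 ↦ I`, `10 ↦ X`, `01 ↦ Z`, `11 ↦ Y`. -/
def pauli (x z : ZMod 2) : Matrix (Fin 2) (Fin 2) ℂ :=
  if x = 0 then (if z = 0 then 1 else pauliZ) else (if z = 0 then pauliX else pauliY)

/-- The Pauli string with bits `(x, z)`. -/
def pauliString {n : ℕ} (x z : Fin n → ZMod 2) : QOp n :=
  tensorOp fun k => pauli (x k) (z k)

theorem tensorOp_mul {n : ℕ} (A B : Fin n → Matrix (Fin 2) (Fin 2) ℂ) :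
    tensorOp A * tensorOp B = tensorOp fun k => A k * B k := by
  ext x y
  simp only [tensorOp, Matrix.mul_apply, Matrix.of_apply, ← Finset.prod_mul_distrib]
  exact (Fintype.prod_sum fun k b => A k (x k) b * B k b (y k)).symm

theorem tensorOp_smul {n : ℕ} (c : Fin n → ℂ) (A : Fin n → Matrix (Fin 2) (Fin 2) ℂ) :
    tensorOp (fun k => c k • A k) = (∏ k, c k) • tensorOp A := by
  ext x y
  simp [tensorOp, Finset.prod_mul_distrib]

theorem tensorOp_one {n : ℕ} : tensorOp (fun _ : Fin n => 1) = 1 := by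
  ext x y
  by_cases h : x = y
  · subst h
    simp [tensorOp]
  · obtain ⟨k, hk⟩ := Function.ne_iff.mp h
    rw [Matrix.one_apply_ne h]
    exact Finset.prod_eq_zero (Finset.mem_univ k) (Matrix.one_apply_ne hk)

theorem pauli_mul_self (x z : ZMod 2) : pauli x z * pauli x z = 1 := by
  unfold pauli
  split_ifs <;> ext i j <;> fin_cases i <;> fin_cases j <;>
    simp [pauliX, pauliY, pauliZ, Matrix.mul_apply]

theorem pauli_mul (x z x' z' : ZMod 2) :
    ∃ m : ℕ, pauli x z * pauli x' z' = Complex.I ^ m • pauli (x + x') (z + z') := by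
  have h2 : (1 : ZMod 2) + 1 = 0 := rfl
  have key : ∀ m : ℕ, pauli x z * pauli x' z' = Complex.I ^ m • pauli (x + x') (z + z') →
      ∃ m : ℕ, pauli x z * pauli x' z' = Complex.I ^ m • pauli (x + x') (z + z') :=
    fun m h => ⟨m, h⟩
  have bit : ∀ a : ZMod 2, a = 0 ∨ a = 1 := by decide
  rcases bit x with rfl | rfl <;> rcases bit z with rfl | rfl <;>
    rcases bit x' with rfl | rfl <;> rcases bit z' with rfl | rfl <;>
    first
    | (refine key 0 ?_; ext i j; fin_cases i <;> fin_cases j <;>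
        simp [h2, pauli, pauliX, pauliY, pauliZ, Matrix.mul_apply]; done)
    | (refine key 1 ?_; ext i j; fin_cases i <;> fin_cases j <;>
        simp [h2, pauli, pauliX, pauliY, pauliZ, Matrix.mul_apply]; done)
    | (refine key 3 ?_; ext i j; fin_cases i <;> fin_cases j <;>
        simp [h2, pauli, pauliX, pauliY, pauliZ, Matrix.mul_apply, Complex.I_pow_three])

theorem pauliString_mul_self {n : ℕ} (x z : Fin n → ZMod 2) :
    pauliString x z * pauliString x z = 1 := by
  simp only [pauliString, tensorOp_mul, pauli_mul_self, tensorOp_one]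

theorem pauliString_mul {n : ℕ} (x z x' z' : Fin n → ZMod 2) :
    ∃ m : ℕ, pauliString x z * pauliString x' z' =
      Complex.I ^ m • pauliString (x + x') (z + z') := by
  choose m hm using fun k => pauli_mul (x k) (z k) (x' k) (z' k)
  refine ⟨∑ k, m k, ?_⟩
  simp only [pauliString, tensorOp_mul, hm, tensorOp_smul, Finset.prod_pow_eq_pow_sum,
    Pi.add_apply]

/-- The `n`-qubit Pauli group: all `i^m P` with `P` a Pauli string. -/
def pauliGroup (n : ℕ) : Subgroup (QOp n)ˣ where
  carrier := {u | ∃ (m : ℕ) (x z : Fin n → ZMod 2),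
    (u : QOp n) = Complex.I ^ m • pauliString x z}
  one_mem' := ⟨0, 0, 0, by simp [pauliString, pauli, tensorOp_one]⟩
  mul_mem' := by
    rintro u v ⟨a, x, z, hu⟩ ⟨b, x', z', hv⟩
    obtain ⟨c, hc⟩ := pauliString_mul x z x' z'
    refine ⟨a + b + c, x + x', z + z', ?_⟩
    rw [Units.val_mul, hu, hv, smul_mul_smul_comm, hc, smul_smul, ← pow_add, ← pow_add]
  inv_mem' := by
    rintro u ⟨a, x, z, hu⟩
    refine ⟨3 * a, x, z, ?_⟩
    rw [Units.inv_eq_of_mul_eq_one_right]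
    rw [hu, smul_mul_smul_comm, pauliString_mul_self, ← pow_add,
      show a + 3 * a = 4 * a by ring, pow_mul, Complex.I_pow_four, one_pow, one_smul]

/-- The stabilizer group of `ψ`: the elements of the Pauli group that fix `ψ`. -/
def stabilizerGroup {n : ℕ} (ψ : QVec n) : Subgroup (QOp n)ˣ where
  carrier := {u | u ∈ pauliGroup n ∧ (u : QOp n) *ᵥ ψ = ψ}
  one_mem' := ⟨one_mem _, by simp⟩
  mul_mem' := by
    rintro u v ⟨hu, hu'⟩ ⟨hv, hv'⟩
    exact ⟨mul_mem hu hv, by rw [Units.val_mul, ← Matrix.mulVec_mulVec, hv', hu']⟩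
  inv_mem' := by
    rintro u ⟨hu, hu'⟩
    refine ⟨inv_mem hu, ?_⟩
    nth_rewrite 1 [← hu']
    rw [Matrix.mulVec_mulVec, Units.inv_mul, Matrix.one_mulVec]

/-! ### Stabilizer tableaux -/

/-- The operator `(-1)^r P` encoded by the `2n+1` bits `(x, z, r)`. -/
def signedPauli {n : ℕ} (x z : Fin n → ZMod 2) (r : ZMod 2) : (QOp n)ˣ where
  val := (-1 : ℂ) ^ r.val • pauliString x z
  inv := (-1 : ℂ) ^ r.val • pauliString x z
  val_inv := by
    rw [smul_mul_smul_comm, pauliString_mul_self, ← mul_pow]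
    simp
  inv_val := by
    rw [smul_mul_smul_comm, pauliString_mul_self, ← mul_pow]
    simp

/-- An `n × (2n+1)` binary tableau, given by its `X` part, `Z` part and phase column. -/
structure Tableau (n : ℕ) where
  xPart : Matrix (Fin n) (Fin n) (ZMod 2)
  zPart : Matrix (Fin n) (Fin n) (ZMod 2)
  phase : Fin n → ZMod 2

/-- The signed Pauli operator encoded by the `j`-th row of a tableau. -/
def Tableau.row {n : ℕ} (T : Tableau n) (j : Fin n) : (QOp n)ˣ :=
  signedPauli (T.xPart j) (T.zPart j) (T.phase j)

/-- `T` is a stabilizer tableau of the (stabilizer) state `ψ`: its rows generate the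
stabilizer group of `ψ`, and they determine `ψ` up to a scalar. -/
structure IsStabilizerTableau {n : ℕ} (T : Tableau n) (ψ : QVec n) : Prop where
  ne_zero : ψ ≠ 0
  generates : Subgroup.closure (Set.range T.row) = stabilizerGroup ψ
  determines : ∀ φ : QVec n, (∀ j, (T.row j : QOp n) *ᵥ φ = φ) → ∃ c : ℂ, φ = c • ψ

/-- The operator `- X₁ ⋯ X_{j-1} Y_j X_{j+1} ⋯ Xₙ`. -/
def negXYX {n : ℕ} (j : Fin n) : QOp n :=
  -tensorOp fun k => if k = j then pauliY else pauliX

/-! ### IQP circuits -/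

/-- `Ham(H)`, the sum over the rows `p` of `H` of `X₁^{p₁} ⊗ ⋯ ⊗ Xₙ^{pₙ}`. -/
def iqpHam {ι : Type*} [Fintype ι] {n : ℕ} (H : Matrix ι (Fin n) (ZMod 2)) : QOp n :=
  ∑ i, pauliString (H i) 0

/-- The IQP circuit `exp(i θ Ham(H))`. -/
def iqpCircuit {ι : Type*} [Fintype ι] {n : ℕ} (H : Matrix ι (Fin n) (ZMod 2)) (θ : ℝ) :
    QOp n :=
  NormedSpace.exp ((Complex.I * (θ : ℂ)) • iqpHam H)

/-- The matrix element `⟨0^n| A |0^n⟩`. -/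
def vacuumElement {n : ℕ} (A : QOp n) : ℂ := star (ketZero n) ⬝ᵥ (A *ᵥ ketZero n)

/-- The correlation function `⟨Z_s⟩ = ⟨0^n| U† Z_s U |0^n⟩` of the circuit
`U = exp(i θ Ham(H))`, where `Z_s = Z₁^{s₁} ⊗ ⋯ ⊗ Zₙ^{sₙ}`. -/
def correlationFunction {ι : Type*} [Fintype ι] {n : ℕ} (H : Matrix ι (Fin n) (ZMod 2))
    (θ : ℝ) (s : Fin n → ZMod 2) : ℂ :=
  vacuumElement ((iqpCircuit H θ)ᴴ * pauliString 0 s * iqpCircuit H θ)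

/-! ### The quadratic-residue code -/

open Classical in
/-- The indicator of the nonzero quadratic residues modulo `q`. -/
def qrIndicator (q : ℕ) (a : ZMod q) : ZMod 2 := if a ≠ 0 ∧ IsSquare a then 1 else 0

/-- The cyclic generator of the quadratic-residue code, shifted down by `j` places.
Positions are numbered from `1` to `q`, so the position of `i : Fin q` is `i + 1`. -/
def qrcShift (q : ℕ) (j : ℕ) : Fin q → ZMod 2 :=
  fun i => qrIndicator q (((i : ℕ) : ZMod q) + 1 - (j : ZMod q))

/-- The quadratic-residue code of length `q`: the cyclic code spanned by all cyclic
shifts of the cyclic generator. -/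
def qrCode (q : ℕ) : Submodule (ZMod 2) (Fin q → ZMod 2) :=
  Submodule.span (ZMod 2) (Set.range (qrcShift q))

/-- `H` consists of an all-ones column followed by the basis of the quadratic-residue code
of length `q` that is formed by the cyclic generator and its successive shifts. -/
structure IsQRCMatrix (q k : ℕ) (H : Matrix (Fin q) (Fin (k + 1)) (ZMod 2)) : Prop where
  first_col : ∀ i, H i 0 = 1
  shift_col : ∀ (i : Fin q) (j : Fin k), H i j.succ = qrcShift q j i
  independent : LinearIndependent (ZMod 2) fun j : Fin k => qrcShift q j
  spanning : Submodule.span (ZMod 2) (Set.range fun j : Fin k => qrcShift q j) = qrCode q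

end

noncomputable section

/-! ### Signs of bits and weights of binary words -/

/-! In the Hadamard basis the circuit is diagonal: the vector labelled `y` is an eigenvector of the
Hamiltonian with eigenvalue `signSum (H *ᵥ y)`, the length minus twice the weight of the codeword `H
*ᵥ y`. At angle π/4 only its class modulo 8 matters. The columns of the matrix have weights ≡ 3 (mod
4) and pairwise odd intersections, in length ≡ 7 (mod 8), so `signSum_sum` makes this class -1 or 1
according to whether the parity of `y` is even or odd. Hence the circuit acts as (1 - i X⊗⋯⊗X)/√2,
and the state is (|0^n⟩ - i|1^n⟩)/√2 (`iqpCircuit_mulVec_ketZero_of_signSum`). The stabilizer group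
(`closure_onesTableau_row`) and the amplitude 1/√2 at 0 are read off from this state.

The weights and intersections come from the quadratic character χ: its sum is 0, and its
autocorrelation at a nonzero shift is -1, a Jacobi sum. The dimension (q+1)/2 is squeezed between
two bounds: the code modulo the all-ones word is self-orthogonal (`finrank_qrCode_le`), and the code
together with its reversal spans everything (`le_finrank_qrCode`).

For the correlation function, Z_s anticommutes with the rows of `H` and commutes with those of `R`;
moving it through U† cancels `R` and doubles the angle on `H`. -/

/-- The sign `(-1)^a` of a bit. -/
def bitSign (a : ZMod 2) : ℤ := (-1) ^ a.val

theorem bit_eq (a : ZMod 2) : a = 0 ∨ a = 1 := by revert a; decide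

@[simp] theorem bitSign_zero : bitSign 0 = 1 := rfl

@[simp] theorem bitSign_one : bitSign 1 = -1 := rfl

theorem bitSign_add (a b : ZMod 2) : bitSign (a + b) = bitSign a * bitSign b := by
  revert a b; decide

theorem bitSign_sum {ι : Type*} (s : Finset ι) (f : ι → ZMod 2) :
    bitSign (∑ i ∈ s, f i) = ∏ i ∈ s, bitSign (f i) := by
  induction s using Finset.cons_induction with
  | empty => simp
  | cons a s ha ih => rw [Finset.sum_cons, Finset.prod_cons, bitSign_add, ih]

theorem bitSign_mul_self (a : ZMod 2) : bitSign a * bitSign a = 1 := by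
  revert a; decide

theorem bitSign_eq_one_iff {a : ZMod 2} : bitSign a = 1 ↔ a = 0 := by
  revert a; decide

/-- The sum of the signs of a binary word: its length minus twice its weight. -/
def signSum {ι : Type*} [Fintype ι] (c : ι → ZMod 2) : ℤ := ∑ i, bitSign (c i)

/-- The integer size of an intersection and the bit `u ⬝ᵥ v` agree modulo 2, so four times the
former is known modulo 8. -/
theorem exists_sum_mul_val {ι : Type*} (s : Finset ι) (u v : ι → ZMod 2) :
    ∃ t : ℤ, ∑ i ∈ s, ((u i).val * (v i).val : ℤ) = ((∑ i ∈ s, u i * v i).val : ℤ) + 2 * t := by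
  have key : ∀ a b c : ZMod 2, ∃ t : ℤ, (a.val * b.val : ℤ) + c.val = (a * b + c).val + 2 * t := by
    intro a b c
    rcases bit_eq a with rfl | rfl <;> rcases bit_eq b with rfl | rfl <;>
      rcases bit_eq c with rfl | rfl <;>
      first
      | exact ⟨0, by decide⟩
      | exact ⟨1, by decide⟩
  induction s using Finset.cons_induction with
  | empty => exact ⟨0, by simp⟩
  | cons a s ha ih =>
    obtain ⟨t, ht⟩ := ih
    obtain ⟨t', ht'⟩ := key (u a) (v a) (∑ i ∈ s, u i * v i)
    exact ⟨t + t', by rw [Finset.sum_cons, Finset.sum_cons, ht]; linarith⟩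

/-- Sum over positions the identity (-1)^(a+b) = (-1)^a + (-1)^b - 1 + 4ab; the last term counts the
intersection. -/
theorem signSum_add {ι : Type*} [Fintype ι] (u v : ι → ZMod 2) :
    signSum (u + v) ≡ signSum u + signSum v - Fintype.card ι + 4 * (u ⬝ᵥ v).val [ZMOD 8] := by
  have key : ∀ a b : ZMod 2,
      bitSign (a + b) = bitSign a + bitSign b - 1 + 4 * (a.val * b.val) := by decide
  obtain ⟨t, ht⟩ := exists_sum_mul_val Finset.univ u v
  have : signSum (u + v) =
      signSum u + signSum v - Fintype.card ι + 4 * ∑ i, ((u i).val * (v i).val : ℤ) := by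
    simp only [signSum, Pi.add_apply, key, Finset.sum_add_distrib, Finset.sum_sub_distrib,
      Finset.mul_sum]
    simp
  rw [this, ht, Int.modEq_iff_dvd]
  exact ⟨-t, by simp only [dotProduct]; ring⟩

/-- Binary vectors with pairwise odd intersections and weights `≡ 3 (mod 4)`, in length
`≡ 7 (mod 8)`: the weight of a combination modulo `4` depends only on the parity of the number
of its terms. -/
theorem signSum_sum {ι κ : Type*} [Fintype ι] (hι : (Fintype.card ι : ℤ) ≡ -1 [ZMOD 8])
    (c : κ → ι → ZMod 2) (hc : ∀ j, signSum (c j) ≡ 1 [ZMOD 8])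
    (hd : ∀ j j', j ≠ j' → c j ⬝ᵥ c j' = 1) (y : κ → ZMod 2) (s : Finset κ) :
    signSum (∑ j ∈ s, y j • c j) ≡ -bitSign (∑ j ∈ s, y j) [ZMOD 8] := by
  induction s using Finset.cons_induction with
  | empty => simpa [signSum] using hι
  | cons a s ha ih =>
    rw [Finset.sum_cons, Finset.sum_cons]
    rcases bit_eq (y a) with h | h
    · simpa [h] using ih
    -- All intersections with the new vector are odd, so its overlap with the partial sum is the
    -- parity of the number of terms used so far.
    · have hdot : c a ⬝ᵥ (∑ j ∈ s, y j • c j) = ∑ j ∈ s, y j := by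
        rw [dotProduct_sum]
        refine Finset.sum_congr rfl fun j hj => ?_
        rw [dotProduct_smul, hd a j (by rintro rfl; exact ha hj), smul_eq_mul, mul_one]
      have h1 := signSum_add (c a) (∑ j ∈ s, y j • c j)
      rw [hdot] at h1
      rw [h, one_smul]
      refine h1.trans ?_
      have h2 := hc a
      simp only [Int.ModEq] at *
      rcases bit_eq (∑ j ∈ s, y j) with h3 | h3 <;> rw [h3] at ih ⊢
      · have : bitSign (1 + 0) = -1 := rfl
        rw [this]
        simp only [bitSign_zero, ZMod.val_zero] at ih ⊢
        omega
      · have : bitSign (1 + 1) = 1 := rfl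
        have h4 : (1 : ZMod 2).val = 1 := rfl
        rw [this, h4]
        simp only [bitSign_one] at ih ⊢
        omega

/-! ### Correlations of the quadratic character -/

/-- Substituting a = dt turns the sum into χ(-1) J(χ, χ), and J(χ, χ⁻¹) = -χ(-1) with χ = χ⁻¹. -/
theorem quadraticChar_sum_mul_sub {F : Type*} [Field F] [Fintype F] [DecidableEq F]
    (hF : ringChar F ≠ 2) {d : F} (hd : d ≠ 0) :
    ∑ a : F, quadraticChar F a * quadraticChar F (a - d) = -1 := by
  set χ := quadraticChar F
  have hsq : ∀ a : F, a ≠ 0 → χ a * χ a = 1 := fun a ha => by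
    rw [← sq]; exact quadraticChar_sq_one ha
  have h1 : ∑ a : F, χ a * χ (a - d) = ∑ t : F, χ (-1) * (χ t * χ (1 - t)) := by
    refine Fintype.sum_equiv (Equiv.mulLeft₀ d hd).symm _ _ fun a => ?_
    simp only [Equiv.mulLeft₀_symm_apply]
    have e1 : χ a = χ d * χ (d⁻¹ * a) := by rw [← map_mul, mul_inv_cancel_left₀ hd]
    have e2 : χ (a - d) = χ d * (χ (-1) * χ (1 - d⁻¹ * a)) := by
      rw [← map_mul, ← map_mul]; congr 1; field_simp; ring
    rw [e1, e2]
    linear_combination χ (d⁻¹ * a) * χ (-1) * χ (1 - d⁻¹ * a) * hsq d hd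
  have h2 := jacobiSum_nontrivial_inv (quadraticChar_ne_one hF)
  rw [(quadraticChar_isQuadratic F).inv, jacobiSum] at h2
  rw [h1, ← Finset.mul_sum, h2]
  linear_combination -hsq (-1) (by simp)

theorem qrcShift_mem {q : ℕ} (j : ℕ) : qrcShift q j ∈ qrCode q := Submodule.subset_span ⟨j, rfl⟩

theorem one_dotProduct_one_of_eight_dvd {q : ℕ} (h8 : 8 ∣ q + 1) : (1 : Fin q → ZMod 2) ⬝ᵥ 1 = 1 := by
  simp only [dotProduct, Pi.one_apply, mul_one, Finset.sum_const, Finset.card_univ,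
    Fintype.card_fin, nsmul_eq_mul]
  rw [ZMod.natCast_eq_one_iff_odd, Nat.odd_iff]
  omega

section QRC

variable {q : ℕ} [Fact q.Prime]

theorem ringChar_ne_two_of_eight_dvd (h8 : 8 ∣ q + 1) : ringChar (ZMod q) ≠ 2 := by
  rw [ZMod.ringChar_zmod_n]; omega

theorem quadraticChar_neg_one_of_eight_dvd (h8 : 8 ∣ q + 1) : quadraticChar (ZMod q) (-1) = -1 := by
  rw [quadraticChar_neg_one_iff_not_isSquare, ZMod.exists_sq_eq_neg_one_iff]
  omega

theorem quadraticChar_neg_of_eight_dvd (h8 : 8 ∣ q + 1) (a : ZMod q) :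
    quadraticChar (ZMod q) (-a) = -quadraticChar (ZMod q) a := by
  rw [neg_eq_neg_one_mul, map_mul, quadraticChar_neg_one_of_eight_dvd h8, neg_one_mul]

theorem bitSign_qrIndicator (a : ZMod q) :
    bitSign (qrIndicator q a) = (if a = 0 then 1 else 0) - quadraticChar (ZMod q) a := by
  by_cases ha : a = 0
  · simp [qrIndicator, ha]
  · by_cases hs : IsSquare a
    · simp [qrIndicator, ha, hs, (quadraticChar_one_iff_isSquare ha).2 hs]
    · simp [qrIndicator, ha, hs, quadraticChar_neg_one_iff_not_isSquare.2 hs]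

theorem sum_bitSign_qrIndicator (h8 : 8 ∣ q + 1) (d : ZMod q) :
    ∑ a : ZMod q, bitSign (qrIndicator q (a - d)) = 1 := by
  rw [Fintype.sum_equiv (Equiv.subRight d) (fun a => bitSign (qrIndicator q (a - d)))
    (fun a => bitSign (qrIndicator q a)) fun a => rfl]
  simp only [bitSign_qrIndicator, Finset.sum_sub_distrib, Finset.sum_ite_eq', Finset.mem_univ,
    if_true, quadraticChar_sum_zero (ringChar_ne_two_of_eight_dvd h8), sub_zero]

/-- The sign is -χ except at 0, where it is 1. The two resulting corrections, at a = 0 and a = d,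
cancel because χ is odd. -/
theorem sum_bitSign_qrIndicator_mul (h8 : 8 ∣ q + 1) {d : ZMod q} (hd : d ≠ 0) :
    ∑ a : ZMod q, bitSign (qrIndicator q a) * bitSign (qrIndicator q (a - d)) = -1 := by
  have key : ∀ a : ZMod q, bitSign (qrIndicator q a) * bitSign (qrIndicator q (a - d)) =
      quadraticChar (ZMod q) a * quadraticChar (ZMod q) (a - d)
        - (if a = 0 then quadraticChar (ZMod q) (-d) else 0)
        - (if a = d then quadraticChar (ZMod q) d else 0) := by
    intro a
    simp only [bitSign_qrIndicator, sub_eq_zero]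
    by_cases h0 : a = 0
    · subst h0; simp [hd.symm]
    · by_cases h1 : a = d
      · subst h1; simp [hd]
      · simp [h0, h1]
  simp only [key, Finset.sum_sub_distrib,
    quadraticChar_sum_mul_sub (ringChar_ne_two_of_eight_dvd h8) hd, Finset.sum_ite_eq',
    Finset.mem_univ, if_true, quadraticChar_neg_of_eight_dvd h8]
  ring

/-! ### Shifts of the cyclic generator -/

/-- The positions `1, …, q` as residues modulo `q`. -/
def qrPosition (q : ℕ) [Fact q.Prime] : Fin q ≃ ZMod q :=
  Equiv.ofBijective (fun i => ((i : ℕ) : ZMod q) + 1) <| by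
    rw [Fintype.bijective_iff_injective_and_card]
    refine ⟨fun i j h => ?_, by simp [ZMod.card]⟩
    have := (ZMod.natCast_eq_natCast_iff' _ _ _).1 (add_right_cancel h)
    rw [Nat.mod_eq_of_lt i.2, Nat.mod_eq_of_lt j.2] at this
    exact Fin.ext this

theorem qrcShift_apply (j : ℕ) (i : Fin q) :
    qrcShift q j i = qrIndicator q (qrPosition q i - j) := rfl

theorem signSum_qrcShift (h8 : 8 ∣ q + 1) (j : ℕ) : signSum (qrcShift q j) = 1 := by
  rw [← sum_bitSign_qrIndicator h8 (j : ZMod q)]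
  exact Fintype.sum_equiv (qrPosition q) _ _ fun i => rfl

theorem signSum_qrcShift_add (h8 : 8 ∣ q + 1) {j j' : ℕ} (h : (j : ZMod q) ≠ j') :
    signSum (qrcShift q j + qrcShift q j') = -1 := by
  rw [← sum_bitSign_qrIndicator_mul h8 (sub_ne_zero.2 h.symm)]
  refine Fintype.sum_equiv ((qrPosition q).trans (Equiv.subRight (j : ZMod q))) _ _ fun i => ?_
  simp [bitSign_add, qrcShift_apply]

/-- The weight of the sum of two shifts is known, so `signSum_add` can be solved for the
intersection bit modulo 8. Equal shifts fit too: the zero word has sign sum q ≡ -1. -/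
theorem qrcShift_dotProduct (h8 : 8 ∣ q + 1) (j j' : ℕ) :
    qrcShift q j ⬝ᵥ qrcShift q j' = 1 := by
  have h := signSum_add (qrcShift q j) (qrcShift q j')
  rw [signSum_qrcShift h8, signSum_qrcShift h8, Fintype.card_fin] at h
  have hS : signSum (qrcShift q j + qrcShift q j') ≡ -1 [ZMOD 8] := by
    by_cases hj : (j : ZMod q) = j'
    · have : qrcShift q j = qrcShift q j' := by
        funext i; rw [qrcShift_apply, qrcShift_apply, hj]
      rw [this, show qrcShift q j' + qrcShift q j' = 0 from CharTwo.add_self_eq_zero _]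
      simp only [signSum, Pi.zero_apply, bitSign_zero, Finset.sum_const, Finset.card_univ,
        Fintype.card_fin, Int.ModEq, nsmul_eq_mul]
      omega
    · rw [signSum_qrcShift_add h8 hj]
  rcases bit_eq (qrcShift q j ⬝ᵥ qrcShift q j') with h0 | h0
  · rw [h0] at h
    simp only [Int.ModEq, ZMod.val_zero] at h hS
    omega
  · exact h0

theorem one_dotProduct_qrcShift (h8 : 8 ∣ q + 1) (j : ℕ) : 1 ⬝ᵥ qrcShift q j = 1 := by
  rw [← qrcShift_dotProduct h8 j j]
  refine Finset.sum_congr rfl fun i _ => ?_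
  have : ∀ a : ZMod 2, 1 * a = a * a := by decide
  exact this _

theorem signSum_qrcMatrix_mulVec (h8 : 8 ∣ q + 1) {k : ℕ}
    {H : Matrix (Fin q) (Fin (k + 1)) (ZMod 2)} (hH : IsQRCMatrix q k H)
    (y : Fin (k + 1) → ZMod 2) : signSum (H *ᵥ y) ≡ -bitSign (∑ j, y j) [ZMOD 8] := by
  have hsum : H *ᵥ y = ∑ j, y j • Hᵀ j := by
    funext i
    simp [mulVec, dotProduct, Finset.sum_apply, mul_comm]
  have h0 : Hᵀ 0 = 1 := funext hH.first_col
  have hs : ∀ j : Fin k, Hᵀ j.succ = qrcShift q j := fun j => funext fun i => hH.shift_col i j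
  rw [hsum]
  refine signSum_sum ?_ _ (fun j => ?_) (fun j j' _ => ?_) y _
  · rw [Fintype.card_fin, Int.modEq_iff_dvd]; omega
  · cases j using Fin.cases with
    | zero =>
      simp only [h0, signSum, Pi.one_apply, bitSign_one, Finset.sum_const, Finset.card_univ,
        Fintype.card_fin, Int.ModEq, nsmul_eq_mul]
      omega
    | succ j => rw [hs, signSum_qrcShift h8]
  · cases j using Fin.cases with
    | zero =>
      cases j' using Fin.cases with
      | zero => contradiction
      | succ j' => rw [h0, hs, one_dotProduct_qrcShift h8]
    | succ j =>
      cases j' using Fin.cases with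
      | zero => rw [h0, hs, dotProduct_comm, one_dotProduct_qrcShift h8]
      | succ j' => rw [hs, hs, qrcShift_dotProduct h8]

/-! ### The dimension of the quadratic-residue code -/

theorem one_mem_qrCode (h8 : 8 ∣ q + 1) : (1 : Fin q → ZMod 2) ∈ qrCode q := by
  -- In the sum of all q shifts each position counts the weight of the generator, which is odd.
  have : (1 : Fin q → ZMod 2) = ∑ a : ZMod q, qrcShift q a.val := by
    funext i
    rw [Finset.sum_apply, Pi.one_apply, ← one_dotProduct_qrcShift h8 0, dotProduct]
    refine Fintype.sum_equiv ((qrPosition q).trans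
      (Equiv.subLeft (qrPosition q i))) _ _ fun l => ?_
    simp [qrcShift_apply]
  rw [this]
  exact Submodule.sum_mem _ fun a _ => qrcShift_mem _

theorem qrCode_dotProduct (h8 : 8 ∣ q + 1) {u v : Fin q → ZMod 2} (hu : u ∈ qrCode q)
    (hv : v ∈ qrCode q) : u ⬝ᵥ v = (1 ⬝ᵥ u) * (1 ⬝ᵥ v) := by
  induction hu, hv using Submodule.span_induction₂ with
  | mem_mem u v hu hv =>
    obtain ⟨j, rfl⟩ := hu
    obtain ⟨j', rfl⟩ := hv
    rw [qrcShift_dotProduct h8, one_dotProduct_qrcShift h8, one_dotProduct_qrcShift h8, one_mul]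
  | zero_left => simp
  | zero_right => simp
  | add_left x y z _ _ _ h1 h2 => rw [add_dotProduct, dotProduct_add, h1, h2, add_mul]
  | add_right x y z _ _ _ h1 h2 => rw [dotProduct_add, dotProduct_add, h1, h2, mul_add]
  | smul_left r x y _ _ h => rw [smul_dotProduct, dotProduct_smul, h, smul_mul_assoc]
  | smul_right r x y _ _ h => rw [dotProduct_smul, dotProduct_smul, h, mul_smul_comm]

theorem finrank_qrCode_le (h8 : 8 ∣ q + 1) : 2 * Module.finrank (ZMod 2) (qrCode q) ≤ q + 1 := by
  set B := Matrix.toBilin' (1 : Matrix (Fin q) (Fin q) (ZMod 2)) with hB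
  have hBapp : ∀ u v, B u v = u ⬝ᵥ v := fun u v => by
    rw [hB, Matrix.toBilin'_apply', Matrix.one_mulVec]
  have hnd : B.Nondegenerate :=
    LinearMap.BilinForm.nondegenerate_toBilin'_of_det_ne_zero' _ (by simp)
  have horth := LinearMap.BilinForm.finrank_orthogonal hnd (qrCode q)
  rw [Module.finrank_fin_fun] at horth
  -- Subtracting `(1 ⬝ᵥ u) • 1` makes `u` even, and even codewords are orthogonal to the whole code
  -- by `qrCode_dotProduct`.
  have hle : qrCode q ≤ B.orthogonal (qrCode q) ⊔ (ZMod 2) ∙ (1 : Fin q → ZMod 2) := by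
    intro u hu
    rw [Submodule.mem_sup]
    refine ⟨u - (1 ⬝ᵥ u) • 1, ?_, (1 ⬝ᵥ u) • 1,
      Submodule.smul_mem _ _ (Submodule.mem_span_singleton_self _), sub_add_cancel _ _⟩
    intro v hv
    rw [hBapp, qrCode_dotProduct h8 hv
      (sub_mem hu (Submodule.smul_mem _ _ (one_mem_qrCode h8))), dotProduct_sub, dotProduct_smul,
      one_dotProduct_one_of_eight_dvd h8, smul_eq_mul, mul_one, sub_self, mul_zero]
  have h1 := Submodule.finrank_mono hle
  have h2 := Submodule.finrank_add_le_finrank_add_finrank (B.orthogonal (qrCode q))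
    ((ZMod 2) ∙ (1 : Fin q → ZMod 2))
  have h3 := finrank_span_le_card (R := ZMod 2) ({1} : Set (Fin q → ZMod 2))
  simp only [Set.toFinset_singleton, Finset.card_singleton] at h3
  omega

/-- Since -1 is a non-residue, exactly one of a and -a is a residue when a ≠ 0. -/
theorem qrIndicator_add_neg (h8 : 8 ∣ q + 1) (a : ZMod q) :
    1 + qrIndicator q a + qrIndicator q (-a) = if a = 0 then 1 else 0 := by
  by_cases ha : a = 0
  · simp [ha, qrIndicator]
  · have h := quadraticChar_neg_of_eight_dvd h8 a
    have hna : -a ≠ 0 := neg_ne_zero.2 ha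
    by_cases hs : IsSquare a
    · rw [(quadraticChar_one_iff_isSquare ha).2 hs, quadraticChar_neg_one_iff_not_isSquare] at h
      simp [qrIndicator, ha, hs, h]
      rfl
    · rw [quadraticChar_neg_one_iff_not_isSquare.2 hs, neg_neg,
        quadraticChar_one_iff_isSquare hna] at h
      simp [qrIndicator, ha, hs, h]
      rfl

/-- The reversal of the cyclic positions. -/
def qrReversal (q : ℕ) [Fact q.Prime] : (Fin q → ZMod 2) ≃ₗ[ZMod 2] (Fin q → ZMod 2) :=
  LinearEquiv.funCongrLeft (ZMod 2) (ZMod 2)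
    (((qrPosition q).trans (Equiv.neg _)).trans (qrPosition q).symm)

theorem qrReversal_apply (c : Fin q → ZMod 2) (i : Fin q) :
    qrReversal q c i = c ((qrPosition q).symm (-qrPosition q i)) := rfl

theorem sup_map_qrReversal (h8 : 8 ∣ q + 1) :
    qrCode q ⊔ (qrCode q).map (qrReversal q : (Fin q → ZMod 2) →ₗ[ZMod 2] (Fin q → ZMod 2)) = ⊤ := by
  rw [eq_top_iff, ← (Pi.basisFun (ZMod 2) (Fin q)).span_eq, Submodule.span_le]
  rintro _ ⟨i, rfl⟩
  set m := qrPosition q i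
  have : Pi.basisFun (ZMod 2) (Fin q) i =
      (1 + qrcShift q m.val) + qrReversal q (qrcShift q (-m).val) := by
    funext l
    have h := qrIndicator_add_neg h8 (qrPosition q l - m)
    simp only [Pi.basisFun_apply, Pi.add_apply, Pi.one_apply, qrReversal_apply, qrcShift_apply,
      Equiv.apply_symm_apply, ZMod.natCast_zmod_val]
    rw [show -qrPosition q l - -m = -(qrPosition q l - m) by ring, h]
    simp [sub_eq_zero, m, Pi.single_apply]
  rw [this]
  exact Submodule.add_mem_sup (add_mem (one_mem_qrCode h8) (qrcShift_mem _))
    (Submodule.mem_map_of_mem (qrcShift_mem _))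

theorem le_finrank_qrCode (h8 : 8 ∣ q + 1) : q + 1 ≤ 2 * Module.finrank (ZMod 2) (qrCode q) := by
  have h1 := Submodule.finrank_sup_add_finrank_inf_eq (qrCode q)
    ((qrCode q).map (qrReversal q : (Fin q → ZMod 2) →ₗ[ZMod 2] (Fin q → ZMod 2)))
  rw [sup_map_qrReversal h8, finrank_top, Module.finrank_fin_fun,
    LinearEquiv.finrank_map_eq] at h1
  -- The all-ones word is invariant under reversal; this intersection supplies the +1 in the bound.
  have hne : qrCode q ⊓
      (qrCode q).map (qrReversal q : (Fin q → ZMod 2) →ₗ[ZMod 2] (Fin q → ZMod 2)) ≠ ⊥ := by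
    rw [Submodule.ne_bot_iff]
    refine ⟨1, ⟨one_mem_qrCode h8, 1, one_mem_qrCode h8, rfl⟩, fun h => ?_⟩
    have := one_dotProduct_one_of_eight_dvd h8
    rw [h] at this
    simp at this
  have h2 := Submodule.one_le_finrank_iff.2 hne
  omega

theorem finrank_qrCode (h8 : 8 ∣ q + 1) : Module.finrank (ZMod 2) (qrCode q) = (q + 1) / 2 := by
  have h1 := finrank_qrCode_le h8
  have h2 := le_finrank_qrCode h8
  omega

end QRC

/-! ### Cyclic bases -/

/-- The span of the orbit of a vector under a linear map is spanned by as many initial elements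
of the orbit as its dimension. -/
theorem span_orbit_eq {K V : Type*} [Field K] [AddCommGroup V] [Module K V]
    [FiniteDimensional K V] (T : V →ₗ[K] V) (v : ℕ → V) (hv : ∀ j, T (v j) = v (j + 1)) :
    Submodule.span K (Set.range fun j :
      Fin (Module.finrank K (Submodule.span K (Set.range v))) => v j) =
      Submodule.span K (Set.range v) := by
  set C := Submodule.span K (Set.range v)
  set S : ℕ → Submodule K V := fun m => Submodule.span K (Set.range fun j : Fin m => v j) with hS
  have hmem : ∀ {i m : ℕ}, i < m → v i ∈ S m := fun {i m} h => Submodule.subset_span ⟨⟨i, h⟩, rfl⟩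
  have hSC : ∀ m, S m ≤ C := fun m => Submodule.span_mono (by rintro _ ⟨j, rfl⟩; exact ⟨j, rfl⟩)
  have hmono : ∀ m, S m ≤ S (m + 1) := fun m =>
    Submodule.span_le.2 (by rintro _ ⟨j, rfl⟩; exact hmem (j.2.trans (Nat.lt_succ_self m)))
  -- Once the next orbit element is already in the span, the span is `T`-invariant and contains `v
  -- 0`, hence the whole orbit. Until then each step raises the rank.
  have hstable : ∀ m, v m ∈ S m → S m = C := by
    intro m hm
    have hT : S m ≤ (S m).comap T := by
      refine Submodule.span_le.2 ?_
      rintro _ ⟨j, rfl⟩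
      simp only [Submodule.comap_coe, Set.mem_preimage, SetLike.mem_coe, hv]
      rcases Nat.lt_or_ge (j + 1) m with h | h
      · exact hmem h
      · rwa [show (j : ℕ) + 1 = m by have := j.2; omega]
    have h0 : v 0 ∈ S m := by
      rcases Nat.eq_zero_or_pos m with rfl | h
      · exact hm
      · exact hmem h
    refine le_antisymm (hSC m) (Submodule.span_le.2 ?_)
    rintro _ ⟨j, rfl⟩
    induction j with
    | zero => exact h0
    | succ j ih => rw [← hv]; exact hT ih
  have hrank : ∀ m, S m = C ∨ m ≤ Module.finrank K (S m) := by
    intro m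
    induction m with
    | zero => exact Or.inr (Nat.zero_le _)
    | succ m ih =>
      by_cases hm : v m ∈ S m
      · exact Or.inl (le_antisymm (hSC _) ((hstable m hm).symm.le.trans (hmono m)))
      · rcases ih with ih | ih
        · exact absurd (ih ▸ Submodule.subset_span ⟨m, rfl⟩) hm
        · have hlt : S m < S (m + 1) :=
            lt_of_le_of_ne (hmono m) fun h => hm (h ▸ hmem (Nat.lt_succ_self m))
          have := Submodule.finrank_lt_finrank_of_lt hlt
          exact Or.inr (by omega)
  rcases hrank (Module.finrank K C) with h | h
  · exact h
  · exact Submodule.eq_of_le_of_finrank_le (hSC _) h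

theorem span_qrcShift_initial {q : ℕ} [Fact q.Prime] :
    Submodule.span (ZMod 2)
      (Set.range fun j : Fin (Module.finrank (ZMod 2) (qrCode q)) => qrcShift q j) = qrCode q := by
  refine span_orbit_eq (LinearMap.funLeft (ZMod 2) (ZMod 2)
    (((qrPosition q).trans (Equiv.subRight 1)).trans (qrPosition q).symm)) (qrcShift q) fun j => ?_
  funext i
  simp only [LinearMap.funLeft_apply, qrcShift_apply, Equiv.trans_apply, Equiv.apply_symm_apply,
    Equiv.subRight_apply, Nat.cast_add, Nat.cast_one]
  congr 1
  ring

theorem exists_isQRCMatrix {q : ℕ} [Fact q.Prime] :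
    ∃ (k : ℕ) (H : Matrix (Fin q) (Fin (k + 1)) (ZMod 2)), IsQRCMatrix q k H := by
  refine ⟨Module.finrank (ZMod 2) (qrCode q),
    Matrix.of fun i => Fin.cons 1 fun j => qrcShift q j i, fun i => rfl, fun i j => rfl, ?_,
    span_qrcShift_initial⟩
  rw [linearIndependent_iff_card_eq_finrank_span, Fintype.card_fin, Set.finrank,
    span_qrcShift_initial]

theorem IsQRCMatrix.finrank_eq {q k : ℕ} {H : Matrix (Fin q) (Fin (k + 1)) (ZMod 2)}
    (hH : IsQRCMatrix q k H) : Module.finrank (ZMod 2) (qrCode q) = k := by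
  rw [← hH.spanning, finrank_span_eq_card hH.independent, Fintype.card_fin]

/-! ### Amplitudes -/

/-- The amplitude of a vector at a word of bits. -/
def amp {n : ℕ} (φ : QVec n) (a : Fin n → ZMod 2) : ℂ := φ a

/-- The vector with given amplitudes. -/
def ofAmp {n : ℕ} (f : (Fin n → ZMod 2) → ℂ) : QVec n := f

theorem amp_ofAmp {n : ℕ} (f : (Fin n → ZMod 2) → ℂ) (a : Fin n → ZMod 2) :
    amp (ofAmp f) a = f a := rfl

/-- `Fin 2` and `ZMod 2` are definitionally equal; going through `amp` lets basis labels be added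
and paired as vectors over the two-element field. -/
theorem amp_ext {n : ℕ} {φ ψ : QVec n} (h : ∀ a, amp φ a = amp ψ a) : φ = ψ := funext h

theorem amp_smul {n : ℕ} (c : ℂ) (φ : QVec n) (a : Fin n → ZMod 2) :
    amp (c • φ) a = c * amp φ a := rfl

theorem amp_neg {n : ℕ} (φ : QVec n) (a : Fin n → ZMod 2) : amp (-φ) a = -amp φ a := rfl

theorem amp_sum {ι : Type*} {n : ℕ} (s : Finset ι) (φ : ι → QVec n) (a : Fin n → ZMod 2) :
    amp (∑ i ∈ s, φ i) a = ∑ i ∈ s, amp (φ i) a := Finset.sum_apply _ _ _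

/-- The basis state labelled by a word of bits. -/
def basisKet {n : ℕ} (b : Fin n → ZMod 2) : QVec n := ofAmp fun a => if a = b then 1 else 0

theorem ketZero_eq_basisKet (n : ℕ) : ketZero n = basisKet 0 := by
  refine amp_ext fun a => ?_
  exact Pi.single_apply (M := ℂ) (0 : Fin n → ZMod 2) 1 a

theorem QOp.ext_amp {n : ℕ} {A B : QOp n} (h : ∀ φ a, amp (A *ᵥ φ) a = amp (B *ᵥ φ) a) : A = B :=
  Matrix.ext_of_mulVec_single fun _ => amp_ext (h _)

theorem vacuumElement_eq {n : ℕ} (A : QOp n) : vacuumElement A = amp (A *ᵥ ketZero n) 0 := by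
  unfold vacuumElement
  generalize A *ᵥ ketZero n = φ
  simp only [ketZero, ← Pi.single_star, star_one, single_one_dotProduct]
  rfl

/-! ### Pauli strings acting on vectors -/

/-- The entries of a one-qubit Pauli operator, indexed by bits. -/
def pauliEntry (x z a b : ZMod 2) : ℂ := pauli x z a b

theorem pauliEntry_of_ne {x z a b : ZMod 2} (h : b ≠ a + x) : pauliEntry x z a b = 0 := by
  rcases bit_eq x with rfl | rfl <;> rcases bit_eq z with rfl | rfl <;>
    rcases bit_eq a with rfl | rfl <;> rcases bit_eq b with rfl | rfl <;>
    first
    | exact absurd (by decide) h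
    | (simp [pauliEntry, pauli, pauliX, pauliY, pauliZ]; rfl)

theorem pauliEntry_x (x a : ZMod 2) : pauliEntry x 0 a (a + x) = 1 := by
  rcases bit_eq x with rfl | rfl <;> rcases bit_eq a with rfl | rfl <;>
    simp [pauliEntry, pauli, pauliX] <;> rfl

theorem pauliEntry_z (z a : ZMod 2) : pauliEntry 0 z a a = bitSign (z * a) := by
  rcases bit_eq z with rfl | rfl <;> rcases bit_eq a with rfl | rfl <;>
    simp [pauliEntry, pauli, pauliZ] <;> rfl

theorem pauliEntry_y (a : ZMod 2) : pauliEntry 1 1 a (a + 1) = -(Complex.I * bitSign a) := by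
  rcases bit_eq a with rfl | rfl <;> simp [pauliEntry, pauli, pauliY] <;> rfl

/-- A Pauli string is a monomial matrix: row `a` has its only nonzero entry in column `a + x`. -/
theorem amp_pauliString_mulVec {n : ℕ} (x z : Fin n → ZMod 2) (φ : QVec n)
    (a : Fin n → ZMod 2) :
    amp (pauliString x z *ᵥ φ) a =
      (∏ k, pauliEntry (x k) (z k) (a k) (a k + x k)) * amp φ (a + x) := by
  refine Finset.sum_eq_single (M := ℂ) (f := fun b => pauliString x z a b * φ b) (a + x)
    (fun b _ hb => ?_) (fun h => absurd (Finset.mem_univ _) h)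
  obtain ⟨k, hk⟩ := Function.ne_iff.mp hb
  have : pauliString x z a b = 0 :=
    Finset.prod_eq_zero (Finset.mem_univ k) (pauliEntry_of_ne hk)
  rw [this, zero_mul]

theorem amp_xString_mulVec {n : ℕ} (x : Fin n → ZMod 2) (φ : QVec n) (a : Fin n → ZMod 2) :
    amp (pauliString x 0 *ᵥ φ) a = amp φ (a + x) := by
  simp only [amp_pauliString_mulVec, Pi.zero_apply, pauliEntry_x, Finset.prod_const_one, one_mul]

theorem amp_zString_mulVec {n : ℕ} (z : Fin n → ZMod 2) (φ : QVec n) (a : Fin n → ZMod 2) :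
    amp (pauliString 0 z *ᵥ φ) a = bitSign (z ⬝ᵥ a) * amp φ a := by
  simp only [amp_pauliString_mulVec, add_zero, Pi.zero_apply, pauliEntry_z, dotProduct,
    bitSign_sum, Int.cast_prod]

theorem zString_mul {n : ℕ} (z z' : Fin n → ZMod 2) :
    pauliString 0 z * pauliString 0 z' = pauliString 0 (z + z') := by
  refine QOp.ext_amp fun φ a => ?_
  simp only [← mulVec_mulVec, amp_zString_mulVec, add_dotProduct, bitSign_add]
  push_cast
  ring

theorem xString_commute {n : ℕ} (x x' : Fin n → ZMod 2) :
    Commute (pauliString x 0) (pauliString x' 0) := by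
  refine QOp.ext_amp fun φ a => ?_
  simp only [← mulVec_mulVec, amp_xString_mulVec, add_right_comm]

theorem zString_mul_xString {n : ℕ} (s x : Fin n → ZMod 2) :
    pauliString 0 s * pauliString x 0 =
      (bitSign (x ⬝ᵥ s) : ℂ) • (pauliString x 0 * pauliString 0 s) := by
  refine QOp.ext_amp fun φ a => ?_
  simp only [smul_mulVec, ← mulVec_mulVec, amp_zString_mulVec, amp_xString_mulVec, amp_smul,
    dotProduct_add, bitSign_add, dotProduct_comm x s]
  have := congrArg (Int.cast : ℤ → ℂ) (bitSign_mul_self (s ⬝ᵥ x))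
  push_cast at this ⊢
  linear_combination (-(bitSign (s ⬝ᵥ a) : ℂ) * amp φ (a + x)) * this

theorem pauli_conjTranspose_apply (x z : ZMod 2) (a b : Fin 2) :
    star (pauli x z b a) = pauli x z a b := by
  rcases bit_eq x with rfl | rfl <;> rcases bit_eq z with rfl | rfl <;>
    fin_cases a <;> fin_cases b <;> simp [pauli, pauliX, pauliY, pauliZ]

theorem pauliString_conjTranspose {n : ℕ} (x z : Fin n → ZMod 2) :
    (pauliString x z)ᴴ = pauliString x z := by
  ext a b
  rw [conjTranspose_apply]
  simp only [pauliString, tensorOp, Matrix.of_apply, star_prod]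
  exact Finset.prod_congr rfl fun k _ => pauli_conjTranspose_apply _ _ _ _

/-! ### The Hadamard basis -/

/-- Apply the exponential series to `v` term by term; evaluation at `v` is additive and continuous.
-/
theorem exp_mulVec_eq_of_eigenvector {m : Type*} [Fintype m] [DecidableEq m] (A : Matrix m m ℂ)
    (v : m → ℂ) (c : ℂ) (h : A *ᵥ v = c • v) :
    NormedSpace.exp A *ᵥ v = Complex.exp c • v := by
  have hpow : ∀ k : ℕ, (A ^ k) *ᵥ v = c ^ k • v := by
    intro k
    induction k with
    | zero => simp
    | succ k ih => rw [pow_succ, ← mulVec_mulVec, h, mulVec_smul, ih, smul_smul, pow_succ, mul_comm]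
  open scoped Norms.Operator in
  have hA := NormedSpace.exp_series_hasSum_exp' (𝕂 := ℂ) A
  have hc := NormedSpace.exp_series_hasSum_exp' (𝕂 := ℂ) c
  have hcont : Continuous fun M : Matrix m m ℂ => M *ᵥ v :=
    continuous_id.matrix_mulVec continuous_const
  have h1 := hA.map (⟨⟨fun M => M *ᵥ v, zero_mulVec v⟩, fun M N => add_mulVec M N v⟩ :
    Matrix m m ℂ →+ (m → ℂ)) hcont
  have h2 := hc.smul_const v
  rw [Complex.exp_eq_exp_ℂ]
  refine h1.unique ?_
  convert h2 using 2 with k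
  simp [smul_mulVec, hpow, smul_smul]

/-- The (unnormalized) Hadamard basis vector with label `y`. -/
def hadamardVec {n : ℕ} (y : Fin n → ZMod 2) : QVec n := ofAmp fun a => bitSign (y ⬝ᵥ a)

theorem iqpHam_mulVec_hadamardVec {ι : Type*} [Fintype ι] {n : ℕ}
    (H : Matrix ι (Fin n) (ZMod 2)) (y : Fin n → ZMod 2) :
    iqpHam H *ᵥ hadamardVec y = (signSum (H *ᵥ y) : ℂ) • hadamardVec y := by
  refine amp_ext fun a => ?_
  rw [iqpHam, sum_mulVec, amp_sum, amp_smul, signSum, Int.cast_sum, Finset.sum_mul]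
  refine Finset.sum_congr rfl fun i _ => ?_
  rw [amp_xString_mulVec, hadamardVec, amp_ofAmp, amp_ofAmp, dotProduct_add, bitSign_add,
    dotProduct_comm y (H i), mulVec, Int.cast_mul, mul_comm]

theorem iqpCircuit_mulVec_hadamardVec {ι : Type*} [Fintype ι] {n : ℕ}
    (H : Matrix ι (Fin n) (ZMod 2)) (θ : ℝ) (y : Fin n → ZMod 2) :
    iqpCircuit H θ *ᵥ hadamardVec y =
      Complex.exp (Complex.I * θ * signSum (H *ᵥ y)) • hadamardVec y := by
  refine exp_mulVec_eq_of_eigenvector _ _ _ ?_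
  rw [smul_mulVec, iqpHam_mulVec_hadamardVec, smul_smul]

/-- Walsh inversion, with the character sum factored over the qubits: constant signs give |0^n⟩,
parity signs give |1^n⟩. -/
theorem sum_bitSign_smul_hadamardVec {n : ℕ} (c : ZMod 2) :
    ∑ y : Fin n → ZMod 2, (bitSign (c * ∑ j, y j) : ℂ) • hadamardVec y =
      (2 : ℂ) ^ n • basisKet fun _ => c := by
  have key : ∀ a : ZMod 2, ∑ b : ZMod 2, bitSign (c * b) * bitSign (b * a) =
      2 * if a = c then 1 else 0 := by
    revert c; decide
  refine amp_ext fun a => ?_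
  have hL : ∀ y : Fin n → ZMod 2, amp ((bitSign (c * ∑ j, y j) : ℂ) • hadamardVec y) a =
      ((∏ j, (bitSign (c * y j) * bitSign (y j * a j)) : ℤ) : ℂ) := by
    intro y
    rw [Finset.prod_mul_distrib, ← bitSign_sum, ← bitSign_sum, ← Finset.mul_sum, Int.cast_mul]
    rfl
  rw [amp_sum, Finset.sum_congr rfl fun y _ => hL y, ← Int.cast_sum,
    ← Fintype.prod_sum fun j b => bitSign (c * b) * bitSign (b * a j), amp_smul, basisKet,
    amp_ofAmp]
  simp only [key, Finset.prod_mul_distrib, Finset.prod_const, Finset.card_univ, Fintype.card_fin]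
  by_cases h : a = fun _ => c
  · subst h
    simp
  · obtain ⟨k, hk⟩ := Function.ne_iff.mp h
    rw [Finset.prod_eq_zero (Finset.mem_univ k) (if_neg hk), if_neg h]
    simp

theorem exp_eighth_turns {m : ℤ} {e : ZMod 2} (h : m ≡ -bitSign e [ZMOD 8]) :
    Complex.exp (Complex.I * ((Real.pi / 4 : ℝ) : ℂ) * m) =
      (1 / Real.sqrt 2 : ℝ) * (1 - Complex.I * bitSign e) := by
  obtain ⟨t, ht⟩ := h.symm.dvd
  obtain rfl : m = -bitSign e + 8 * t := by linarith
  have hs : ((Real.sqrt 2 / 2 : ℝ) : ℂ) = ((1 / Real.sqrt 2 : ℝ) : ℂ) := by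
    rw [Real.sqrt_div_self']
  have e1 : Complex.I * ((Real.pi / 4 : ℝ) : ℂ) * ((-bitSign e + 8 * t : ℤ) : ℂ) =
      ((-(bitSign e : ℝ) * (Real.pi / 4) : ℝ) : ℂ) * Complex.I + t * (2 * Real.pi * Complex.I) := by
    push_cast; ring
  rw [e1, Complex.exp_add, Complex.exp_int_mul_two_pi_mul_I, mul_one, Complex.exp_mul_I,
    ← Complex.ofReal_cos, ← Complex.ofReal_sin, ← hs]
  rcases bit_eq e with rfl | rfl <;> simp <;> ring

/-! ### The state prepared by the circuit of a quadratic-residue matrix -/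

/-- The state `|0^n⟩ - i|1^n⟩`. -/
def catState (n : ℕ) : QVec n := ketZero n - Complex.I • basisKet 1

theorem iqpCircuit_mulVec_ketZero_of_signSum {ι : Type*} [Fintype ι] {n : ℕ}
    (H : Matrix ι (Fin n) (ZMod 2))
    (hH : ∀ y, signSum (H *ᵥ y) ≡ -bitSign (∑ j, y j) [ZMOD 8]) :
    iqpCircuit H (Real.pi / 4) *ᵥ ketZero n =
      ((1 / Real.sqrt 2 : ℝ) : ℂ) • catState n := by
  have h0 := sum_bitSign_smul_hadamardVec (n := n) 0
  have h1 := sum_bitSign_smul_hadamardVec (n := n) 1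
  simp only [zero_mul, one_mul, bitSign_zero, Int.cast_one, one_smul] at h0 h1
  have h2 : (2 : ℂ) ^ n ≠ 0 := by simp
  have h0' : (2 : ℂ) ^ n • ketZero n = ∑ y, hadamardVec y := by
    rw [ketZero_eq_basisKet]; exact h0.symm
  have h1' : (2 : ℂ) ^ n • basisKet (1 : Fin n → ZMod 2) =
    ∑ y : Fin n → ZMod 2, (bitSign (∑ j, y j) : ℂ) • hadamardVec y := h1.symm
  refine smul_right_injective _ h2 ?_
  simp only
  rw [← mulVec_smul, h0', mulVec_sum, smul_comm, catState, smul_sub, smul_comm _ Complex.I, h0', h1',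
    Finset.smul_sum, ← Finset.sum_sub_distrib, Finset.smul_sum]
  refine Finset.sum_congr rfl fun y _ => ?_
  rw [iqpCircuit_mulVec_hadamardVec, exp_eighth_turns (hH y), smul_smul, ← smul_smul, sub_smul,
    one_smul]

/-! ### The correlation function -/

theorem iqpHam_fromRows {ι κ : Type*} [Fintype ι] [Fintype κ] {n : ℕ}
    (H : Matrix ι (Fin n) (ZMod 2)) (R : Matrix κ (Fin n) (ZMod 2)) :
    iqpHam (fromRows H R) = iqpHam H + iqpHam R := by
  simp only [iqpHam, Fintype.sum_sum_type]
  rfl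

theorem iqpHam_commute {ι κ : Type*} [Fintype ι] [Fintype κ] {n : ℕ}
    (H : Matrix ι (Fin n) (ZMod 2)) (R : Matrix κ (Fin n) (ZMod 2)) :
    Commute (iqpHam H) (iqpHam R) :=
  Commute.sum_left _ _ _ fun _ _ => Commute.sum_right _ _ _ fun _ _ => xString_commute _ _

theorem zString_mul_iqpHam {ι : Type*} [Fintype ι] {n : ℕ} (H : Matrix ι (Fin n) (ZMod 2))
    (s : Fin n → ZMod 2) (e : ZMod 2) (h : ∀ i, (H *ᵥ s) i = e) :
    pauliString 0 s * iqpHam H = (bitSign e : ℂ) • (iqpHam H * pauliString 0 s) := by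
  simp only [iqpHam, Finset.mul_sum, Finset.sum_mul, Finset.smul_sum]
  refine Finset.sum_congr rfl fun i _ => ?_
  rw [zString_mul_xString, ← h i]
  rfl

theorem iqpHam_conjTranspose {ι : Type*} [Fintype ι] {n : ℕ} (H : Matrix ι (Fin n) (ZMod 2)) :
    (iqpHam H)ᴴ = iqpHam H := by
  simp only [iqpHam, conjTranspose_sum, pauliString_conjTranspose]

theorem correlationFunction_fromRows {ι κ : Type*} [Fintype ι] [Fintype κ] {n : ℕ}
    (H : Matrix ι (Fin n) (ZMod 2)) (R : Matrix κ (Fin n) (ZMod 2)) (θ : ℝ) (s : Fin n → ZMod 2)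
    (hH : ∀ i, (H *ᵥ s) i = 1) (hR : ∀ i, (R *ᵥ s) i = 0) :
    correlationFunction (fromRows H R) θ s = vacuumElement (iqpCircuit H (2 * θ)) := by
  set Z := pauliString 0 s with hZ
  have hZZ : Z * Z = 1 := pauliString_mul_self _ _
  set u : (QOp n)ˣ := ⟨Z, Z, hZZ, hZZ⟩
  have hZH : Z * iqpHam H * Z = -iqpHam H := by
    rw [zString_mul_iqpHam H s 1 hH, smul_mul_assoc, mul_assoc, hZZ]; simp
  have hZR : Z * iqpHam R * Z = iqpHam R := by
    rw [zString_mul_iqpHam R s 0 hR, smul_mul_assoc, mul_assoc, hZZ]; simp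
  set c : ℂ := Complex.I * θ with hc
  have hadj : (iqpCircuit (fromRows H R) θ)ᴴ = NormedSpace.exp (-c • (iqpHam H + iqpHam R)) := by
    rw [iqpCircuit, ← exp_conjTranspose, conjTranspose_smul, iqpHam_conjTranspose,
      iqpHam_fromRows]
    congr 2
    simp [hc]
  -- Conjugation by Z_s flips the sign of the `H` part only, so the exponent -c(H + R) becomes c(H -
  -- R).
  have hconj : Z * NormedSpace.exp (-c • (iqpHam H + iqpHam R)) * Z =
      NormedSpace.exp (c • (iqpHam H - iqpHam R)) := by
    have := Matrix.exp_units_conj u (-c • (iqpHam H + iqpHam R))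
    have hu : (u : QOp n) = Z := rfl
    have hu' : ((u⁻¹ : (QOp n)ˣ) : QOp n) = Z := rfl
    rw [hu, hu'] at this
    rw [← this]
    congr 1
    rw [mul_smul_comm, smul_mul_assoc, mul_add, add_mul, hZH, hZR, neg_smul, ← smul_neg]
    congr 1
    abel
  have hcomm : Commute (c • (iqpHam H - iqpHam R)) (c • (iqpHam H + iqpHam R)) :=
    (((iqpHam_commute H H).add_right (iqpHam_commute H R)).sub_left
      ((iqpHam_commute R H).add_right (iqpHam_commute R R))).smul_left c |>.smul_right c
  have hprod : (iqpCircuit (fromRows H R) θ)ᴴ * Z * iqpCircuit (fromRows H R) θ =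
      Z * iqpCircuit H (2 * θ) := by
    calc _ = Z * ((Z * NormedSpace.exp (-c • (iqpHam H + iqpHam R)) * Z) *
          NormedSpace.exp (c • (iqpHam H + iqpHam R))) := by
          rw [hadj, iqpCircuit, iqpHam_fromRows]
          simp only [← mul_assoc, hZZ, one_mul]
          rfl
      _ = _ := by
          rw [hconj, ← Matrix.exp_add_of_commute _ _ hcomm, iqpCircuit, ← smul_add]
          congr 2
          rw [sub_add_add_cancel, ← two_smul ℂ, smul_smul]
          congr 1
          rw [hc]; push_cast; ring
  rw [correlationFunction, hprod, vacuumElement_eq, vacuumElement_eq, ← mulVec_mulVec]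
  -- The remaining Z_s on the left acts trivially on ⟨0^n|.
  have := amp_zString_mulVec s (iqpCircuit H (2 * θ) *ᵥ ketZero n) 0
  rw [dotProduct_zero, bitSign_zero, Int.cast_one, one_mul] at this
  exact this

/-! ### The stabilizer group -/

/-- The tableau with all-ones `X` part, identity `Z` part and all-ones phase column. -/
def onesTableau (n : ℕ) : Tableau n where
  xPart := Matrix.of fun _ _ => 1
  zPart := 1
  phase := fun _ => 1

theorem onesTableau_row_val {n : ℕ} (j : Fin n) :
    ((onesTableau n).row j : QOp n) = -pauliString 1 (Pi.single j 1) := by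
  have h1 : (1 : ZMod 2).val = 1 := rfl
  have hz : (1 : Matrix (Fin n) (Fin n) (ZMod 2)) j = Pi.single j 1 := by
    funext k; rw [Matrix.one_apply, Pi.single_apply]; simp only [eq_comm]
  change (-1 : ℂ) ^ (1 : ZMod 2).val • pauliString 1 ((1 : Matrix (Fin n) (Fin n) (ZMod 2)) j) = _
  rw [h1, hz, pow_one, neg_one_smul]

theorem onesTableau_row_val_eq_negXYX {n : ℕ} (j : Fin n) :
    ((onesTableau n).row j : QOp n) = negXYX j := by
  rw [onesTableau_row_val, negXYX, pauliString]
  congr 2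
  funext k
  by_cases h : k = j
  · subst h; simp [pauli]
  · simp [pauli, h]

theorem amp_onesTableau_row_mulVec {n : ℕ} (j : Fin n) (φ : QVec n) (a : Fin n → ZMod 2) :
    amp (((onesTableau n).row j : QOp n) *ᵥ φ) a =
      Complex.I * bitSign (a j) * amp φ (a + 1) := by
  rw [onesTableau_row_val, neg_mulVec, amp_neg, amp_pauliString_mulVec, Finset.prod_eq_single j]
  · rw [Pi.one_apply, Pi.single_eq_same, pauliEntry_y]
    ring
  · intro k _ hk
    rw [Pi.single_eq_of_ne hk, pauliEntry_x]
  · exact fun h => absurd (Finset.mem_univ _) h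

theorem signedPauli_zero_val {n : ℕ} (z : Fin n → ZMod 2) :
    (signedPauli 0 z 0 : QOp n) = pauliString 0 z := by
  change (-1 : ℂ) ^ (0 : ZMod 2).val • pauliString 0 z = _
  rw [ZMod.val_zero, pow_zero, one_smul]

theorem one_add_one_bits {n : ℕ} : (1 : Fin n → ZMod 2) + 1 = 0 :=
  funext fun _ => CharTwo.add_self_eq_zero 1

/-- The X parts cancel, and the second factor sees the flipped bit, so the phases multiply to i ·
(-i) = 1: the product is Z_i Z_j with no sign. -/
theorem onesTableau_row_mul_row {n : ℕ} (i j : Fin n) :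
    (onesTableau n).row i * (onesTableau n).row j =
      signedPauli 0 (Pi.single i 1 + Pi.single j 1) 0 := by
  refine Units.ext (QOp.ext_amp fun φ a => ?_)
  rw [signedPauli_zero_val, Units.val_mul, ← mulVec_mulVec, amp_onesTableau_row_mulVec,
    amp_onesTableau_row_mulVec, amp_zString_mulVec, add_dotProduct, single_one_dotProduct,
    single_one_dotProduct, bitSign_add, add_assoc, one_add_one_bits, add_zero, Pi.add_apply,
    bitSign_add, Pi.one_apply, bitSign_one]
  push_cast
  linear_combination (-(bitSign (a i) : ℂ) * bitSign (a j) * amp φ a) * Complex.I_mul_I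

theorem signedPauli_zero_mul {n : ℕ} (z z' : Fin n → ZMod 2) :
    signedPauli 0 z 0 * signedPauli 0 z' 0 = signedPauli 0 (z + z') 0 :=
  Units.ext <| by
    rw [Units.val_mul, signedPauli_zero_val, signedPauli_zero_val, signedPauli_zero_val, zString_mul]

theorem signedPauli_zero_mem_closure {n : ℕ} (z : Fin (n + 1) → ZMod 2) (hz : ∑ k, z k = 0) :
    signedPauli 0 z 0 ∈ Subgroup.closure (Set.range (onesTableau (n + 1)).row) := by
  set G := Subgroup.closure (Set.range (onesTableau (n + 1)).row)
  have hpair : ∀ k, signedPauli 0 (Pi.single k 1 + Pi.single 0 1) 0 ∈ G := fun k => by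
    rw [← onesTableau_row_mul_row]
    exact mul_mem (Subgroup.subset_closure ⟨k, rfl⟩) (Subgroup.subset_closure ⟨0, rfl⟩)
  have hzero : signedPauli (n := n + 1) 0 0 0 ∈ G := by
    have := signedPauli_zero_mul (n := n + 1) 0 0
    rw [add_zero, mul_eq_left] at this
    rw [this]
    exact one_mem _
  -- The multiples of the unit vector at 0 add up to the parity of `z`, which is zero.
  have hsum : z = ∑ k, z k • (Pi.single k 1 + Pi.single 0 1 : Fin (n + 1) → ZMod 2) := by
    simp only [smul_add, Finset.sum_add_distrib, ← Finset.sum_smul, hz, zero_smul, add_zero]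
    exact pi_eq_sum_univ' z
  rw [hsum]
  refine Finset.sum_induction _ (fun z => signedPauli 0 z 0 ∈ G)
    (fun z z' h h' => by rw [← signedPauli_zero_mul]; exact mul_mem h h') hzero fun k _ => ?_
  rcases bit_eq (z k) with h | h
  · rw [h, zero_smul]; exact hzero
  · rw [h, one_smul]; exact hpair k

theorem onesTableau_row_mem_pauliGroup {n : ℕ} (j : Fin n) :
    (onesTableau n).row j ∈ pauliGroup n :=
  ⟨2, 1, Pi.single j 1, by rw [onesTableau_row_val, Complex.I_sq, neg_one_smul]⟩

theorem stabilizerGroup_smul {n : ℕ} {c : ℂ} (hc : c ≠ 0) (ψ : QVec n) :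
    stabilizerGroup (c • ψ) = stabilizerGroup ψ := by
  ext u
  change _ ∧ _ ↔ _ ∧ _
  rw [mulVec_smul, (smul_right_injective _ hc).eq_iff]

theorem zero_ne_one_bits {n : ℕ} : (0 : Fin (n + 1) → ZMod 2) ≠ 1 := fun h =>
  zero_ne_one (congrFun h 0)

theorem amp_catState {n : ℕ} (a : Fin n → ZMod 2) :
    amp (catState n) a = (if a = 0 then 1 else 0) - Complex.I * if a = 1 then 1 else 0 := by
  rw [catState, ketZero_eq_basisKet]
  rfl

theorem amp_catState_zero {n : ℕ} : amp (catState (n + 1)) 0 = 1 := by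
  simp [amp_catState]

theorem amp_catState_one {n : ℕ} : amp (catState (n + 1)) 1 = -Complex.I := by
  simp [amp_catState, zero_ne_one_bits.symm]

theorem amp_catState_of_ne {n : ℕ} {a : Fin n → ZMod 2} (h0 : a ≠ 0) (h1 : a ≠ 1) :
    amp (catState n) a = 0 := by
  simp [amp_catState, h0, h1]

theorem eq_smul_catState {n : ℕ} (φ : QVec (n + 1))
    (h : ∀ j, ((onesTableau (n + 1)).row j : QOp (n + 1)) *ᵥ φ = φ) :
    φ = amp φ 0 • catState (n + 1) := by
  have hrow : ∀ (j : Fin (n + 1)) (a : Fin (n + 1) → ZMod 2),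
      amp φ a = Complex.I * bitSign (a j) * amp φ (a + 1) := fun j a => by
    rw [← amp_onesTableau_row_mulVec, h]
  refine amp_ext fun a => ?_
  rw [amp_smul]
  by_cases h0 : a = 0
  · rw [h0, amp_catState_zero, mul_one]
  by_cases h1 : a = 1
  · rw [h1, amp_catState_one, hrow 0 1, one_add_one_bits]
    simp
    ring
  · rw [amp_catState_of_ne h0 h1, mul_zero]
    have hj : ∃ j, a j ≠ a 0 := by
      by_contra! hc
      rcases bit_eq (a 0) with h2 | h2
      · exact h0 (funext fun j => (hc j).trans h2)
      · exact h1 (funext fun j => (hc j).trans h2)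
    obtain ⟨j, hj⟩ := hj
    have hs : ∀ b c : ZMod 2, b ≠ c → bitSign b = -bitSign c := by decide
    have e1 := hrow j a
    have e2 := hrow 0 a
    rw [hs _ _ hj] at e1
    push_cast at e1
    -- Two rows reading different bits of `a` give the same amplitude with opposite signs, so it
    -- vanishes.
    linear_combination (e1 + e2) / 2

theorem onesTableau_row_mulVec_catState {n : ℕ} (j : Fin (n + 1)) :
    ((onesTableau (n + 1)).row j : QOp (n + 1)) *ᵥ catState (n + 1) = catState (n + 1) := by
  refine amp_ext fun a => ?_
  rw [amp_onesTableau_row_mulVec]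
  by_cases h0 : a = 0
  · rw [h0, zero_add, amp_catState_zero, amp_catState_one]; simp
  by_cases h1 : a = 1
  · rw [h1, one_add_one_bits, amp_catState_zero, amp_catState_one]; simp
  · have h2 : a + 1 ≠ 0 := fun h => h1 (by rw [← add_zero a, ← one_add_one_bits (n := n + 1), ← add_assoc, h, zero_add])
    have h3 : a + 1 ≠ 1 := fun h => h0 (by simpa using h)
    rw [amp_catState_of_ne h0 h1, amp_catState_of_ne h2 h3, mul_zero]

/-- Fixing the amplitude at 0 forces the phase to be 1; fixing the one at the all-ones word forces
`z` to have even weight. -/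
theorem mem_closure_of_xPart_eq_zero {n : ℕ} {u : (QOp (n + 1))ˣ} {m : ℕ}
    {z : Fin (n + 1) → ZMod 2} (hu : (u : QOp (n + 1)) = Complex.I ^ m • pauliString 0 z)
    (hψ : (u : QOp (n + 1)) *ᵥ catState (n + 1) = catState (n + 1)) :
    u ∈ Subgroup.closure (Set.range (onesTableau (n + 1)).row) := by
  have happ : ∀ a : Fin (n + 1) → ZMod 2,
      Complex.I ^ m * (bitSign (z ⬝ᵥ a) * amp (catState (n + 1)) a) = amp (catState (n + 1)) a := fun a => by
    nth_rewrite 2 [← hψ]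
    rw [hu, smul_mulVec, amp_smul, amp_zString_mulVec]
  have hm : Complex.I ^ m = 1 := by
    have := happ 0
    rwa [amp_catState_zero, dotProduct_zero, bitSign_zero, Int.cast_one, mul_one, mul_one] at this
  have hz : ∑ k, z k = 0 := by
    have := happ 1
    rw [amp_catState_one, hm, one_mul, dotProduct_one] at this
    rw [← bitSign_eq_one_iff]
    exact_mod_cast mul_right_cancel₀ (neg_ne_zero.2 Complex.I_ne_zero)
      (this.trans (one_mul _).symm)
  have : u = signedPauli 0 z 0 := by
    refine Units.ext ?_
    rw [signedPauli_zero_val, hu, hm, one_smul]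
  rw [this]
  exact signedPauli_zero_mem_closure z hz

theorem closure_onesTableau_row {n : ℕ} :
    Subgroup.closure (Set.range (onesTableau (n + 1)).row) = stabilizerGroup (catState (n + 1)) := by
  have hrow : ∀ j, (onesTableau (n + 1)).row j ∈ stabilizerGroup (catState (n + 1)) := fun j =>
    ⟨onesTableau_row_mem_pauliGroup j, onesTableau_row_mulVec_catState j⟩
  refine le_antisymm ((Subgroup.closure_le _).2 ?_) ?_
  · rintro _ ⟨j, rfl⟩
    exact hrow j
  · rintro u ⟨⟨m, x, z, hu⟩, hψ⟩
    -- Any other flip would bring an amplitude from outside the support {0, 1} to the word 0.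
    have hx : x = 0 ∨ x = 1 := by
      by_contra! hx
      have h : amp ((u : QOp (n + 1)) *ᵥ catState (n + 1)) 0 = 0 := by
        rw [hu, smul_mulVec, amp_smul, amp_pauliString_mulVec, zero_add,
          amp_catState_of_ne hx.1 hx.2, mul_zero, mul_zero]
      rw [hψ, amp_catState_zero] at h
      exact one_ne_zero h
    rcases hx with rfl | rfl
    · exact mem_closure_of_xPart_eq_zero hu hψ
    · have h0 : (onesTableau (n + 1)).row 0 ∈
          Subgroup.closure (Set.range (onesTableau (n + 1)).row) := Subgroup.subset_closure ⟨0, rfl⟩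
      -- Multiplying by a generator removes the all-ones X part; its sign -1 = i² accounts for the 2
      -- in the new exponent.
      rw [← Subgroup.mul_mem_cancel_left _ h0]
      obtain ⟨c, hc⟩ := pauliString_mul 1 (Pi.single 0 1) (1 : Fin (n + 1) → ZMod 2) z
      refine mem_closure_of_xPart_eq_zero (m := 2 + m + c) (z := Pi.single 0 1 + z) ?_ ?_
      · rw [Units.val_mul, onesTableau_row_val, hu, neg_mul, mul_smul_comm, hc,
          one_add_one_bits, smul_smul,
          pow_add, pow_add, Complex.I_sq, ← neg_smul]
        ring_nf
      · rw [Units.val_mul, ← mulVec_mulVec, hψ, onesTableau_row_mulVec_catState]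

theorem isStabilizerTableau_onesTableau {n : ℕ} {c : ℂ} (hc : c ≠ 0) :
    IsStabilizerTableau (onesTableau (n + 1)) (c • catState (n + 1)) where
  ne_zero h := by
    have := congrArg (amp · 0) h
    simp only [amp_smul, amp_catState_zero, mul_one] at this
    exact hc this
  generates := by rw [stabilizerGroup_smul hc, closure_onesTableau_row]
  determines φ h := ⟨amp φ 0 / c, by
    rw [smul_smul, div_mul_cancel₀ _ hc]
    exact eq_smul_catState φ h⟩

theorem corollary1 (q : ℕ) (hq : q.Prime) (h8 : 8 ∣ q + 1) :
    (∃ (k : ℕ) (H : Matrix (Fin q) (Fin (k + 1)) (ZMod 2)), IsQRCMatrix q k H) ∧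
    ∀ (k : ℕ) (H : Matrix (Fin q) (Fin (k + 1)) (ZMod 2)), IsQRCMatrix q k H →
      k + 1 = (q + 3) / 2 ∧
      IsStabilizerTableau
        { xPart := Matrix.of fun _ _ => 1
          zPart := 1
          phase := fun _ => 1 }
        (iqpCircuit H (Real.pi / 4) *ᵥ ketZero (k + 1)) ∧
      Subgroup.closure {u : (QOp (k + 1))ˣ | ∃ j, (u : QOp (k + 1)) = negXYX j} =
        stabilizerGroup (iqpCircuit H (Real.pi / 4) *ᵥ ketZero (k + 1)) ∧
      (∀ (m : ℕ) (R : Matrix (Fin m) (Fin (k + 1)) (ZMod 2)) (s : Fin (k + 1) → ZMod 2),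
        (∀ i, (H *ᵥ s) i = 1) → (∀ i, (R *ᵥ s) i = 0) →
        correlationFunction (Matrix.fromRows H R) (Real.pi / 8) s =
          vacuumElement (iqpCircuit H (Real.pi / 4))) ∧
      ‖vacuumElement (iqpCircuit H (Real.pi / 4))‖ = 1 / Real.sqrt 2 := by
  have : Fact q.Prime := ⟨hq⟩
  refine ⟨exists_isQRCMatrix, fun k H hH => ?_⟩
  have hψ : iqpCircuit H (Real.pi / 4) *ᵥ ketZero (k + 1) =
      ((1 / Real.sqrt 2 : ℝ) : ℂ) • catState (k + 1) :=
    iqpCircuit_mulVec_ketZero_of_signSum H (signSum_qrcMatrix_mulVec h8 hH)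
  have hc : ((1 / Real.sqrt 2 : ℝ) : ℂ) ≠ 0 := by
    rw [Complex.ofReal_ne_zero]
    positivity
  refine ⟨?_, ?_, ?_, fun m R s hs hR => ?_, ?_⟩
  · have h1 := hH.finrank_eq
    have h2 := finrank_qrCode h8
    omega
  · rw [hψ]
    exact isStabilizerTableau_onesTableau hc
  · rw [hψ, stabilizerGroup_smul hc, ← closure_onesTableau_row]
    congr 1
    ext u
    simp only [Set.mem_ofPred_eq, Set.mem_range, ← onesTableau_row_val_eq_negXYX, Units.val_inj,
      eq_comm]
  · rw [correlationFunction_fromRows H R _ s hs hR]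
    congr 2
    ring
  · rw [vacuumElement_eq, hψ, amp_smul, amp_catState_zero, mul_one, Complex.norm_real, Real.norm_of_nonneg (by positivity)]

end
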